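/- **Multiple Multicast Theorem.** An ADT network $G$ consists of a finite set $\mathcal V$ of supernodes, each supernode $V$ having finite sets $I(V)$ of input ports and $O(V)$ of output ports, together with a set $\mathcal E$ of edges, each going from an output port of one supernode to an input port of another. Assume that $G$ is acyclic, i.e. that the directed graph induced on the supernodes has no directed cycle. Let $\mathcal S,\mathcal T\subseteq\mathcal V$ be disjoint sets of sources and destinations. Each source $S\in\mathcal S$ has independent source processes $\mathcal X(S)=[X(S,1),\dots,X(S,\mu(S))]$ with symbols in a finite field; the other supernodes have none. Given a finite field $\mathbb K$ and coefficients $\alpha,\beta,\varepsilon$ in $\mathbb K$, the port symbols $Y$ are determined by $$Y(e')=\sum_{(e,e')\in\mathcal E}Y(e)\quad(e'\in I(V)),\qquad Y(e)=\sum_{e'\in I(V)}\beta_{(e',e)}Y(e')+\sum_{k=1}^{\mu(V)}\alpha_{(k,e)}X(V,k)\quad(e\in O(V)),$$ where $\mu(V)=0$ for $V\notin\mathcal S$; a destination $T$ forms the symbols $Z(T,i)=\sum_{e'\in I(T)}\varepsilon_{(e',(T,i))}Y(e')$. Let $\mathcal C=\{(S,T,\mathcal X(S)) : S\in\mathcal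 S,\ T\in\mathcal T\}$. The problem $(G,\mathcal C)$ is *solvable over $\mathbb K$* if the coefficients can be chosen in $\mathbb K$ so that, for all values of the source symbols, every $T\in\mathcal T$ reproduces all processes of all sources among its symbols $Z(T,i)$. Let $\mathbb F_q$ be a finite field. For a set $\Omega\subseteq\mathcal V$, let $G_\Omega$ be the $0$-$1$ incidence matrix over $\mathbb F_q$ whose rows are the output ports of supernodes in $\Omega$, whose columns are the input ports of supernodes outside $\Omega$, and whose entry at $(e,e')$ is $1$ iff $(e,e')\in\mathcal E$. Say that the *min-cut max-flow bound* holds if for every $T\in\mathcal T$ and every cut $\Omega\subseteq\mathcal V$ with $T\notin\Omega$ and $\Omega\cap\mathcal S\neq\emptyset$, $$\sum_{S\in\mathcal S\cap\Omega}\mu(S)\ \le\ \operatorname{rank}(G_\Omega).$$ Then: 1. $(G,\mathcal C)$ is solvable over some finite extension field of $\mathbb F_q$ if and only if the min-cut max-flow bound holds. 2. If $q>|\mathcal T|$, then $(G,\mathcal C)$ is solvable over $\mathbb F_q$ itself if and only if the min-cut max-flow bound holds. -/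

import Mathlib

universe u v

/-- A wireless network in the ADT model. Every supernode `v : V` has `numIn v` input ports and
`numOut v` output ports, and unit-capacity edges may join any output port to any input port. -/
structure ADTNetwork (V : Type*) where
  numIn : V → ℕ
  numOut : V → ℕ
  Edge : (Σ v, Fin (numOut v)) → (Σ v, Fin (numIn v)) → Prop

namespace ADTNetwork

/-- All input ports; the first component is the supernode that owns the port. -/
abbrev InPort {V : Type*} (G : ADTNetwork V) : Type _ := Σ v, Fin (G.numIn v)

/-- All output ports; the first component is the supernode that owns the port. -/
abbrev OutPort {V : Type*} (G : ADTNetwork V) : Type _ := Σ v, Fin (G.numOut v)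

/-- Some edge leads from an output port of `u` to an input port of `v`. -/
def Adj {V : Type*} (G : ADTNetwork V) (u v : V) : Prop :=
  ∃ (e : Fin (G.numOut u)) (e' : Fin (G.numIn v)), G.Edge ⟨u, e⟩ ⟨v, e'⟩

/-- There is no directed cycle of supernodes. -/
def IsAcyclic {V : Type*} (G : ADTNetwork V) : Prop :=
  ∀ v, ¬ Relation.TransGen G.Adj v v

open Classical in
/-- The incidence matrix `G_Ω`, over the field `F`, of the bipartite graph between the output ports
in `Ω` and the input ports outside `Ω`. -/
noncomputable def cutMatrix (F : Type*) [Field F] {V : Type*} (G : ADTNetwork V) (Ω : Finset V) :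
    Matrix {e : G.OutPort // e.1 ∈ Ω} {e' : G.InPort // e'.1 ∉ Ω} F :=
  Matrix.of fun e e' => if G.Edge e.1 e'.1 then 1 else 0

open Classical in
/-- The value `rank G_Ω` of the cut `Ω`. -/
noncomputable def cutValue (F : Type*) [Field F] {V : Type*} [Fintype V] (G : ADTNetwork V)
    (Ω : Finset V) : ℕ :=
  (G.cutMatrix F Ω).rank

open Classical in
/-- The min-cut max-flow bound for the destination `t`, where each source `s ∈ S` has rate `μ s`:
for every cut `Ω` with at least one source in `Ω` and with `t` outside `Ω`, the total rate of the
sources in `Ω`, all of which has to cross the cut, is at most the value of the cut. -/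
def SatisfiesCutBound (F : Type*) [Field F] {V : Type*} [Fintype V] (G : ADTNetwork V)
    (μ : V → ℕ) (S : Finset V) (t : V) : Prop :=
  ∀ Ω : Finset V, (∃ s ∈ S, s ∈ Ω) → t ∉ Ω → ∑ s ∈ S with s ∈ Ω, μ s ≤ G.cutValue F Ω

/-- A choice of the coding coefficients, where supernode `v` has the source processes
`X(v, k)`, `k : Fin (μ v)`. -/
structure LinearCode (F : Type*) {V : Type*} (G : ADTNetwork V) (μ : V → ℕ) where
  /-- The coefficient of the source process `X(v, k)` at the output port `j` of `v`. -/
  α : ∀ v, Fin (μ v) → Fin (G.numOut v) → F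
  /-- The coefficient of the input port `i` of `v` at the output port `j` of `v`. -/
  β : ∀ v, Fin (G.numIn v) → Fin (G.numOut v) → F
  /-- The decoding coefficient of the input port `i` of `t` in the process by which `t` reproduces
  the source process `p`. -/
  ε : ∀ t, Fin (G.numIn t) → (Σ v, Fin (μ v)) → F

open Classical in
/-- The symbols `yIn`, `yOut` at the ports obey the network equations for the source symbols `x`:
an input port receives the sum over its incoming edges, and an output port sends the prescribed
combination of the input ports and source processes of its supernode. -/
def LinearCode.Carries {F : Type*} [Field F] {V : Type*} [Fintype V] {G : ADTNetwork V}
    {μ : V → ℕ} (c : LinearCode F G μ) (x : (Σ v, Fin (μ v)) → F)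
    (yIn : G.InPort → F) (yOut : G.OutPort → F) : Prop :=
  (∀ e' : G.InPort, yIn e' = ∑ e : G.OutPort with G.Edge e e', yOut e) ∧
  (∀ (v : V) (j : Fin (G.numOut v)),
    yOut ⟨v, j⟩ = ∑ i, c.β v i j * yIn ⟨v, i⟩ + ∑ k, c.α v k j * x ⟨v, k⟩)

/-- The symbol that `t` generates in order to reproduce the source process `p`. -/
def LinearCode.decode {F : Type*} [Field F] {V : Type*} {G : ADTNetwork V} {μ : V → ℕ}
    (c : LinearCode F G μ) (yIn : G.InPort → F) (t : V) (p : Σ v, Fin (μ v)) : F :=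
  ∑ i, c.ε t i p * yIn ⟨t, i⟩

/-- A connection: `dst` has to reproduce the processes `procs` of `src`. -/
structure Connection {V : Type*} (μ : V → ℕ) where
  src : V
  dst : V
  procs : Finset (Fin (μ src))

/-- The network problem `(G, C)` is solvable over `F`: for some coding coefficients in `F`,
all connections in `C` are established for all values of the source symbols. -/
def Solvable (F : Type*) [Field F] {V : Type*} [Fintype V] (G : ADTNetwork V) (μ : V → ℕ)
    (C : Set (Connection μ)) : Prop :=
  ∃ c : LinearCode F G μ, ∀ x : (Σ v, Fin (μ v)) → F,
    (∃ yIn yOut, c.Carries x yIn yOut) ∧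
    ∀ yIn yOut, c.Carries x yIn yOut →
      ∀ a ∈ C, ∀ k ∈ a.procs, c.decode yIn a.dst ⟨a.src, k⟩ = x ⟨a.src, k⟩

/-- Every source in `S` multicasts all its processes to every destination in `T`. -/
def multipleMulticast {V : Type*} (μ : V → ℕ) (S T : Finset V) : Set (Connection μ) :=
  {a | a.src ∈ S ∧ a.dst ∈ T ∧ a.procs = Finset.univ}

end ADTNetwork

/-! Necessity. Set all source symbols outside a cut `Ω` to zero. If nothing crosses the cut,
acyclicity makes every output outside `Ω` vanish, so the destination decodes zero. Hence the source
symbols in `Ω` embed linearly into the symbols crossing the cut, whose rank is that of `G_Ω`.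

Sufficiency. Fix a destination `t` and let a state be a vector of source symbols and output symbols.
The coding equations at all `v ≠ t`, together with silence at `t` (nothing sent, nothing observed),
form one linear map on states, `codedMap`. If it is injective, `t` can decode. When the nodes of a
cut `Ω` are freed from all equations and the other nodes are silenced, a kernel count turns the cut
bound into a lower bound for the rank (`le_finrank_range_codedMap_of_le_cutValue`). A max-flow
min-cut principle for ranks (`exists_le_finrank_range_codedMap`) combines these bounds for all `Ω`
avoiding `t` into a single code attaining full rank. It replaces the two alternatives "free" and
"silent" at a node by a coding equation, because the largest rank of `C + BγA` over `γ` is the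
smaller of the ranks of `[C B]` and `[C; A]`.

Common code and field size. Each coefficient enters through a rank-one term, so on a coordinate line
through a good code at most one value is bad for each destination. Fixing the coefficients one by
one, any set of `|T| + 1` values suffices. The codes for single destinations may therefore live in
the algebraic closure, while the common one is chosen in `F` as soon as `q > |T|`. Without this
bound one passes to a large finite extension, which does not change the rank of a 0-1 matrix. -/

/-! ### Rank under field extension, and choice of common coordinates. -/

theorem Matrix.rank_map_ringHom {m n F K : Type*} [Fintype m] [Fintype n] [Field F] [Field K]
    (f : F →+* K) (M : Matrix m n F) : (M.map f).rank = M.rank := by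
  classical
  let φ := M.mulVecLin
  let e := (Module.finBasis F (LinearMap.range φ)).equivFun
  let p : (n → F) →ₗ[F] (Fin M.rank → F) := e.toLinearMap ∘ₗ φ.rangeRestrict
  let i : (Fin M.rank → F) →ₗ[F] (m → F) := (LinearMap.range φ).subtype ∘ₗ e.symm.toLinearMap
  have hp : LinearMap.range p = ⊤ := by
    rw [LinearMap.range_eq_top]
    exact e.surjective.comp φ.surjective_rangeRestrict
  have hi : LinearMap.ker i = ⊥ := by
    rw [LinearMap.ker_eq_bot]
    exact (Submodule.injective_subtype _).comp e.symm.injective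
  have hip : i ∘ₗ p = φ := by
    refine LinearMap.ext fun x => ?_
    change ((e.symm (e (φ.rangeRestrict x)) : LinearMap.range φ) : m → F) = φ x
    rw [e.symm_apply_apply]
    rfl
  -- The rank is witnessed by matrix identities alone: `M = i p` through dimension `M.rank` bounds
  -- it above, `j M q = 1` bounds it below, and both survive `f`.
  obtain ⟨q, hq⟩ := p.exists_rightInverse_of_surjective hp
  obtain ⟨j, hj⟩ := i.exists_leftInverse_of_injective hi
  have hM : LinearMap.toMatrix' i * LinearMap.toMatrix' p = M := by
    rw [← LinearMap.toMatrix'_comp, hip]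
    exact LinearMap.toMatrix'_toLin' M
  have h1 : LinearMap.toMatrix' j * M * LinearMap.toMatrix' q = 1 := by
    have : LinearMap.toMatrix' φ = M := LinearMap.toMatrix'_toLin' M
    calc LinearMap.toMatrix' j * M * LinearMap.toMatrix' q
        = LinearMap.toMatrix' (j ∘ₗ (i ∘ₗ p) ∘ₗ q) := by
          rw [hip, LinearMap.toMatrix'_comp, LinearMap.toMatrix'_comp, Matrix.mul_assoc, this]
      _ = LinearMap.toMatrix' ((j ∘ₗ i) ∘ₗ (p ∘ₗ q)) := by simp only [LinearMap.comp_assoc]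
      _ = 1 := by rw [hj, hq, LinearMap.id_comp, LinearMap.toMatrix'_id]
  apply le_antisymm
  · calc (M.map f).rank = ((LinearMap.toMatrix' i).map f * (LinearMap.toMatrix' p).map f).rank := by
          rw [← Matrix.map_mul, hM]
      _ ≤ ((LinearMap.toMatrix' i).map f).rank := Matrix.rank_mul_le_left _ _
      _ ≤ Fintype.card (Fin M.rank) := Matrix.rank_le_card_width _
      _ = M.rank := Fintype.card_fin _
  · calc M.rank = (1 : Matrix (Fin M.rank) (Fin M.rank) K).rank := by simp
      _ = ((LinearMap.toMatrix' j).map f * M.map f * (LinearMap.toMatrix' q).map f).rank := by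
          rw [← Matrix.map_mul, ← Matrix.map_mul, h1, Matrix.map_one _ f.map_zero f.map_one]
      _ ≤ ((LinearMap.toMatrix' j).map f * M.map f).rank := Matrix.rank_mul_le_left _ _
      _ ≤ (M.map f).rank := Matrix.rank_mul_le_right _ _

/-- Finitely many nonempty sets in a product, each of which misses at most one point of every
coordinate line through one of its points, have a common point with coordinates in any prescribed
set that has more elements than there are sets. -/
theorem exists_common_mem_of_subsingleton_line_compl {ι K τ : Type*} [Finite ι] [DecidableEq ι]
    [Fintype τ] (G : τ → Set (ι → K)) (Z : Finset K) (hZ : Fintype.card τ < Z.card)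
    (hne : ∀ t, (G t).Nonempty)
    (hG : ∀ t, ∀ x ∈ G t, ∀ i, {z | Function.update x i z ∉ G t}.Subsingleton) :
    ∃ x : ι → K, (∀ i, x i ∈ Z) ∧ ∀ t, x ∈ G t := by
  classical
  have key : ∀ s : Set ι, s.Finite →
      ∃ x : τ → ι → K, (∀ t, x t ∈ G t) ∧ ∀ i ∈ s, ∃ z ∈ Z, ∀ t, x t i = z := by
    intro s hs
    induction s, hs using Set.Finite.induction_on with
    | empty =>
      choose x hx using hne
      exact ⟨x, hx, by simp⟩
    | @insert i s his _ ih =>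
      obtain ⟨x, hx, hxs⟩ := ih
      -- The points `x t` may still differ in the coordinates not yet treated. Each `t` excludes at
      -- most one value, so if every `z ∈ Z` were excluded, sending `z` to a culprit would inject
      -- `Z` into `τ`.
      have : ∃ z ∈ Z, ∀ t, Function.update (x t) i z ∈ G t := by
        by_contra! hbad
        have hτ : Nonempty τ := by
          obtain ⟨z, hz⟩ := Finset.card_pos.1 (Nat.zero_lt_of_lt hZ)
          exact ⟨(hbad z hz).choose⟩
        choose! b hb using hbad
        have hinj : Set.InjOn b Z := fun z hz z' hz' h =>
          hG (b z) _ (hx _) i (hb z hz) (by rw [Set.mem_ofPred_eq, h]; exact hb z' hz')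
        have := Finset.card_le_card_of_injOn b (t := Finset.univ) (by simp) hinj
        rw [Finset.card_univ] at this
        omega
      obtain ⟨z, hz, hzG⟩ := this
      refine ⟨fun t => Function.update (x t) i z, hzG, ?_⟩
      rintro k (rfl | hk)
      · exact ⟨z, hz, fun t => by simp⟩
      · obtain ⟨z', hz', h⟩ := hxs k hk
        have : k ≠ i := fun h => his (h ▸ hk)
        exact ⟨z', hz', fun t => by simp [this, h]⟩
  obtain ⟨x, hx, hxs⟩ := key Set.univ Set.finite_univ
  choose z hz hzx using fun i => hxs i (Set.mem_univ i)
  refine ⟨z, hz, fun t => ?_⟩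
  have : x t = z := funext fun i => hzx i t
  exact this ▸ hx t

/-! ### Ranks of perturbed linear maps. -/

section Rank

variable {K W W' P Q : Type*} [Field K] [AddCommGroup W] [Module K W] [AddCommGroup W'] [Module K W']
  [AddCommGroup P] [Module K P] [AddCommGroup Q] [Module K Q] [FiniteDimensional K W]

/-- On a line in the direction of a map of rank one, the rank drops at most once. -/
theorem LinearMap.subsingleton_finrank_range_add_smul_lt (L : W →ₗ[K] W') (φ : W →ₗ[K] K) (w : W')
    {r : ℕ} (hr : r ≤ Module.finrank K (LinearMap.range L)) :
    {z : K | ¬ r ≤ Module.finrank K (LinearMap.range (L + z • φ.smulRight w))}.Subsingleton := by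
  -- `L` is injective on `C`, so a drop below `r` forces the perturbed map to kill a nonzero vector
  -- of `C`.
  obtain ⟨C, hC⟩ := Submodule.exists_isCompl (LinearMap.ker L)
  have hdim : Module.finrank K C = Module.finrank K (LinearMap.range L) := by
    have h1 := Submodule.finrank_add_eq_of_isCompl hC
    have h2 := L.finrank_range_add_finrank_ker
    omega
  have key : ∀ z : K, ¬ r ≤ Module.finrank K (LinearMap.range (L + z • φ.smulRight w)) →
      ∃ p ∈ C, φ p ≠ 0 ∧ L p = -((z * φ p) • w) := by
    intro z hz
    have : ¬ Function.Injective ((L + z • φ.smulRight w).domRestrict C) := by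
      intro hinj
      have h1 := LinearMap.finrank_range_of_inj hinj
      have h2 : Module.finrank K (LinearMap.range ((L + z • φ.smulRight w).domRestrict C)) ≤
          Module.finrank K (LinearMap.range (L + z • φ.smulRight w)) := by
        apply Submodule.finrank_mono
        rintro _ ⟨x, rfl⟩
        exact ⟨x, rfl⟩
      omega
    rw [← LinearMap.ker_eq_bot, Submodule.eq_bot_iff] at this
    push Not at this
    obtain ⟨⟨p, hp⟩, hpk, hp0⟩ := this
    have hL : L p = -((z * φ p) • w) := by
      simp only [LinearMap.mem_ker, LinearMap.domRestrict_apply, LinearMap.add_apply,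
        LinearMap.smul_apply, LinearMap.smulRight_apply, smul_smul] at hpk
      exact eq_neg_of_add_eq_zero_left hpk
    refine ⟨p, hp, fun h0 => hp0 ?_, hL⟩
    have hk : p ∈ LinearMap.ker L := by simp [hL, h0]
    exact Subtype.ext (Submodule.disjoint_def.1 hC.disjoint p hk hp)
  intro z₁ hz₁ z₂ hz₂
  obtain ⟨p₁, hp₁, h₁, hL₁⟩ := key z₁ hz₁
  obtain ⟨p₂, hp₂, h₂, hL₂⟩ := key z₂ hz₂
  -- Both `L p₁` and `L p₂` are multiples of `w`, so this combination cancels them. It also lies in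
  -- `C`, hence is zero, and applying `φ` gives `z₁ = z₂`.
  have hk : (z₂ * φ p₂) • p₁ - (z₁ * φ p₁) • p₂ ∈ LinearMap.ker L := by
    simp only [LinearMap.mem_ker, map_sub, map_smul, hL₁, hL₂, smul_neg, smul_smul]
    rw [mul_comm, sub_self]
  have h0 := Submodule.disjoint_def.1 hC.disjoint _ hk
    (C.sub_mem (C.smul_mem _ hp₁) (C.smul_mem _ hp₂))
  have := congrArg φ h0
  simp only [map_sub, map_smul, smul_eq_mul, map_zero] at this
  have h3 : (z₂ - z₁) * (φ p₁ * φ p₂) = 0 := by linear_combination this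
  rcases mul_eq_zero.1 h3 with h | h
  · exact (sub_eq_zero.1 h).symm
  · exact absurd h (mul_ne_zero h₁ h₂)

/-- The rank of `C + B γ A` can be made as large as the ranks of `[C B]` and `[C; A]` permit. -/
theorem LinearMap.exists_le_finrank_range_add_comp [FiniteDimensional K W'] (C : W →ₗ[K] W')
    (B : P →ₗ[K] W') (A : W →ₗ[K] Q) {r : ℕ}
    (hB : r ≤ Module.finrank K ↥(LinearMap.range C ⊔ LinearMap.range B))
    (hA : r ≤ Module.finrank K (LinearMap.range (C.prod A))) :
    ∃ γ : Q →ₗ[K] P, r ≤ Module.finrank K (LinearMap.range (C + B ∘ₗ γ ∘ₗ A)) := by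
  induction hk : Module.finrank K (LinearMap.ker C) using Nat.strong_induction_on generalizing C with
  | _ k ih =>
  subst hk
  by_cases hr : r ≤ Module.finrank K (LinearMap.range C)
  · exact ⟨0, by rwa [LinearMap.zero_comp, LinearMap.comp_zero, add_zero]⟩
  have hb : ∃ b, B b ∉ LinearMap.range C := by
    by_contra! h
    have : LinearMap.range B ≤ LinearMap.range C := by
      rintro _ ⟨b, rfl⟩
      exact h b
    rw [sup_eq_left.2 this] at hB
    exact hr hB
  have hu : ∃ u, C u = 0 ∧ A u ≠ 0 := by
    by_contra! h
    have : LinearMap.ker (C.prod A) = LinearMap.ker C := by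
      rw [LinearMap.ker_prod]
      exact inf_eq_left.2 h
    have h1 := (C.prod A).finrank_range_add_finrank_ker
    have h2 := C.finrank_range_add_finrank_ker
    rw [this] at h1
    omega
  obtain ⟨b, hb⟩ := hb
  obtain ⟨u, hCu, hAu⟩ := hu
  obtain ⟨ψ, hψ⟩ : ∃ ψ : Module.Dual K Q, ψ (A u) ≠ 0 := by
    by_contra! h
    exact hAu ((Module.forall_dual_apply_eq_zero_iff K (A u)).1 h)
  -- A rank-one correction within the allowed form: it sends `u`, which `C` kills, to a multiple of
  -- `B b` outside `range C`. The kernel shrinks, while `[C; A]` keeps its kernel and the range of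
  -- `[C B]` is not reduced.
  let C' := C + B ∘ₗ ψ.smulRight b ∘ₗ A
  have hC' : ∀ x, C' x = C x + ψ (A x) • B b := fun x => by simp [C']
  have hlt : LinearMap.ker C' < LinearMap.ker C := by
    refine lt_of_le_of_ne (fun x hx => ?_) fun h => ?_
    · rw [LinearMap.mem_ker, hC'] at hx
      by_cases h0 : ψ (A x) = 0
      · simpa [h0] using hx
      · refine absurd ⟨-(ψ (A x))⁻¹ • x, ?_⟩ hb
        rw [map_smul, eq_neg_of_add_eq_zero_left hx, neg_smul, smul_neg, neg_neg, smul_smul,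
          inv_mul_cancel₀ h0, one_smul]
    · have : u ∈ LinearMap.ker C' := h ▸ hCu
      rw [LinearMap.mem_ker, hC', hCu, zero_add] at this
      exact hb ((smul_eq_zero.1 this).resolve_left hψ ▸ Submodule.zero_mem _)
  have hB' : LinearMap.range C ⊔ LinearMap.range B ≤ LinearMap.range C' ⊔ LinearMap.range B := by
    refine sup_le ?_ le_sup_right
    rintro _ ⟨x, rfl⟩
    have : C x = C' x + B (-(ψ (A x) • b)) := by simp [hC']
    rw [this]
    exact Submodule.add_mem_sup ⟨x, rfl⟩ ⟨_, rfl⟩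
  have hA' : r ≤ Module.finrank K (LinearMap.range (C'.prod A)) := by
    have : LinearMap.ker (C'.prod A) = LinearMap.ker (C.prod A) := by
      ext x
      simp only [LinearMap.ker_prod, Submodule.mem_inf, LinearMap.mem_ker, hC']
      refine and_congr_left fun h => ?_
      simp [h]
    have h1 := (C.prod A).finrank_range_add_finrank_ker
    have h2 := (C'.prod A).finrank_range_add_finrank_ker
    rw [this] at h2
    omega
  obtain ⟨γ, hγ⟩ := ih _ (Submodule.finrank_lt_finrank_of_lt hlt) C'
    (hB.trans (Submodule.finrank_mono hB')) hA' rfl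
  refine ⟨ψ.smulRight b + γ, ?_⟩
  rw [LinearMap.add_comp, LinearMap.comp_add, ← add_assoc]
  exact hγ

end Rank

/-! ### Coding equations as a linear map, and max-flow min-cut for its rank. -/

section CodedMap

variable {K V W : Type*} {I O : V → Type*} [Field K] [DecidableEq V] [∀ v, Fintype (I v)]
  [AddCommGroup W] [Module K W]

/-- The equations imposed on a state of a network whose nodes `v` have the input and output symbols
`a v`, `π v`: none at the nodes in `A`, the coding equation at the other nodes in `U`, and the
vanishing of all symbols elsewhere. -/
def codedMap (π : ∀ v, W →ₗ[K] (O v → K)) (a : ∀ v, W →ₗ[K] (I v → K)) (A U : Finset V)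
    (β : ∀ v, Matrix (O v) (I v) K) : W →ₗ[K] (∀ v, (O v → K) × (I v → K)) :=
  LinearMap.pi fun v =>
    if v ∈ A then 0
    else if v ∈ U then (π v - (β v).mulVecLin ∘ₗ a v).prod 0 else (π v).prod (a v)

variable (π : ∀ v, W →ₗ[K] (O v → K)) (a : ∀ v, W →ₗ[K] (I v → K))

theorem codedMap_apply (A U : Finset V) (β : ∀ v, Matrix (O v) (I v) K) (y : W) (v : V) :
    codedMap π a A U β y v =
      if v ∈ A then 0
      else if v ∈ U then (π v y - (β v).mulVec (a v y), 0) else (π v y, a v y) := by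
  unfold codedMap
  rw [LinearMap.pi_apply]
  split_ifs <;> rfl

/-- Changing one coding coefficient changes the coded map by a map of rank at most one. -/
theorem exists_codedMap_update_eq [DecidableEq (Σ v, O v × I v)] (A U : Finset V)
    (x : (Σ v, O v × I v) → K) (p : Σ v, O v × I v) :
    ∃ w, ∀ z, codedMap π a A U (fun v => Matrix.of fun o i => Function.update x p z ⟨v, o, i⟩) =
      codedMap π a A U (fun v => Matrix.of fun o i => x ⟨v, o, i⟩) +
        (z - x p) • (LinearMap.proj p.2.2 ∘ₗ a p.1).smulRight w := by
  classical
  obtain ⟨v, o, i⟩ := p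
  refine ⟨if v ∉ A ∧ v ∈ U then Pi.single v (-Pi.single o 1, 0) else 0, fun z => ?_⟩
  refine LinearMap.ext fun y => funext fun u => ?_
  rw [LinearMap.add_apply, Pi.add_apply, codedMap_apply, codedMap_apply]
  by_cases huv : u = v
  · subst huv
    have hm : (Matrix.of fun o' i' => Function.update x ⟨u, o, i⟩ z ⟨u, o', i'⟩).mulVec (a u y) =
        (Matrix.of fun o' i' => x ⟨u, o', i'⟩).mulVec (a u y) +
          (z - x ⟨u, o, i⟩) • a u y i • Pi.single o 1 := by
      have : (Matrix.of fun o' i' => Function.update x ⟨u, o, i⟩ z ⟨u, o', i'⟩) =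
          (Matrix.of fun o' i' => x ⟨u, o', i'⟩) + Matrix.single o i (z - x ⟨u, o, i⟩) := by
        ext o' i'
        by_cases h : o' = o ∧ i' = i
        · obtain ⟨rfl, rfl⟩ := h
          simp
        · have h' : ¬ (o = o' ∧ i = i') := fun h' => h ⟨h'.1.symm, h'.2.symm⟩
          simp [Matrix.single, h, h']
      rw [this, Matrix.add_mulVec]
      congr 1
      ext o'
      by_cases ho : o' = o
      · subst ho
        simp [Matrix.single_mulVec]
      · simp [Matrix.single_mulVec, ho]
    rw [hm]
    by_cases hA : u ∈ A
    · simp [hA]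
    · by_cases hU : u ∈ U
      · simp only [hA, hU, if_true, if_false, LinearMap.smul_apply, LinearMap.smulRight_apply,
          LinearMap.comp_apply, LinearMap.proj_apply, Pi.smul_apply, Pi.single_eq_same, not_false_eq_true,
          and_self, Prod.smul_mk, smul_neg, smul_zero, Prod.mk_add_mk, add_zero, Prod.mk.injEq, and_true]
        abel
      · simp [hA, hU]
  · have hm : (Matrix.of fun o' i' => Function.update x ⟨v, o, i⟩ z ⟨u, o', i'⟩) =
        (Matrix.of fun o' i' => x ⟨u, o', i'⟩) := by
      ext o' i'
      simp [huv]
    rw [hm, left_eq_add]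
    by_cases h : v ∉ A ∧ v ∈ U
    · simp [h, huv]
    · simp [h]

variable [Fintype V] [∀ v, Fintype (O v)]

/-- Changing one coefficient perturbs each map along a rank-one direction, so each rank condition
excludes at most one value on a coordinate line through a good point. -/
theorem exists_common_le_finrank_range_codedMap [FiniteDimensional K W] {τ : Type*} [Fintype τ]
    (A U : τ → Finset V) (r : τ → ℕ) (Z : Finset K) (hZ : Fintype.card τ < Z.card)
    (h : ∀ t, ∃ β, r t ≤ Module.finrank K (LinearMap.range (codedMap π a (A t) (U t) β))) :
    ∃ β : ∀ v, Matrix (O v) (I v) K, (∀ v o i, β v o i ∈ Z) ∧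
      ∀ t, r t ≤ Module.finrank K (LinearMap.range (codedMap π a (A t) (U t) β)) := by
  classical
  obtain ⟨x, hxZ, hx⟩ := exists_common_mem_of_subsingleton_line_compl
    (fun t => {x : (Σ v, O v × I v) → K | r t ≤ Module.finrank K (LinearMap.range
      (codedMap π a (A t) (U t) fun v => Matrix.of fun o i => x ⟨v, o, i⟩))}) Z hZ
    (fun t => by
      obtain ⟨β, hβ⟩ := h t
      exact ⟨fun p => β p.1 p.2.1 p.2.2, hβ⟩)
    (by
      intro t x hx p z₁ hz₁ z₂ hz₂
      obtain ⟨w, hw⟩ := exists_codedMap_update_eq π a (A t) (U t) x p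
      have key := LinearMap.subsingleton_finrank_range_add_smul_lt _
        (LinearMap.proj p.2.2 ∘ₗ a p.1) w hx
      rw [Set.mem_ofPred_eq, Set.mem_ofPred_eq, hw] at hz₁ hz₂
      exact sub_left_injective (key hz₁ hz₂))
  exact ⟨fun v => Matrix.of fun o i => x ⟨v, o, i⟩, fun v o i => hxZ _, hx⟩

/-- Induction on the set of coded nodes. Freeing a new node `v` or silencing it gives two instances
with fewer coded nodes. A common code for both has the two ranks that limit what a coding equation
at `v` can achieve. -/
theorem exists_le_finrank_range_codedMap [FiniteDimensional K W] [Infinite K] (R : ℕ)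
    (U : Finset V) : ∀ A : Finset V, Disjoint A U →
    (∀ Ω : Finset V, A ⊆ Ω → Ω ⊆ A ∪ U → R + ∑ v ∈ Ωᶜ, Fintype.card (O v) ≤
      Module.finrank K (LinearMap.range (codedMap π a Ω ∅ 0))) →
    ∃ β, R + ∑ v ∈ Aᶜ, Fintype.card (O v) ≤
      Module.finrank K (LinearMap.range (codedMap π a A U β)) := by
  induction U using Finset.induction_on with
  | empty =>
    intro A _ h
    exact ⟨0, h A subset_rfl (by simp)⟩
  | @insert v U hvU ih =>
    intro A hAU h
    have hvA : v ∉ A := fun hv => Finset.disjoint_left.1 hAU hv (Finset.mem_insert_self v U)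
    have hAU' : Disjoint A U := hAU.mono_right (Finset.subset_insert v U)
    have h₁ := ih (insert v A) (Finset.disjoint_insert_left.2 ⟨hvU, hAU'⟩) fun Ω h1 h2 =>
      h Ω ((Finset.subset_insert v A).trans h1) (h2.trans (by
        rw [Finset.insert_union, Finset.union_insert]))
    have h₂ := ih A hAU' fun Ω h1 h2 =>
      h Ω h1 (h2.trans (Finset.union_subset_union_right (Finset.subset_insert v U)))
    -- Two rank conditions must hold at once, so three values suffice.
    obtain ⟨Z, hZ⟩ := Infinite.exists_subset_card_eq K 3
    obtain ⟨β, -, hβ⟩ := exists_common_le_finrank_range_codedMap π a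
      (fun b : Bool => cond b (insert v A) A) (fun _ => U)
      (fun b : Bool => R + ∑ u ∈ (cond b (insert v A) A)ᶜ, Fintype.card (O u)) Z
      (by simp [hZ]) (by
        rintro (_ | _)
        · exact h₂
        · exact h₁)
    let D := codedMap π a (insert v A) U β
    let E := codedMap π a A U β
    have hD : D = codedMap π a (insert v A) U β := rfl
    have hE : E = codedMap π a A U β := rfl
    have hβ₁ : R + ∑ u ∈ (insert v A)ᶜ, Fintype.card (O u) ≤
      Module.finrank K (LinearMap.range D) := hβ true
    have hβ₂ : R + ∑ u ∈ Aᶜ, Fintype.card (O u) ≤ Module.finrank K (LinearMap.range E) := hβ false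
    let B : (O v → K) →ₗ[K] ∀ v, (O v → K) × (I v → K) :=
      LinearMap.single K (fun v => (O v → K) × (I v → K)) v ∘ₗ LinearMap.inl K _ _
    -- `C` is the coded map with zero coefficients at `v`. Since `D` vanishes at `v`, the rank of
    -- `[C B]` is at least that of `D` plus `|O v|`; and `[C; a v]` has the kernel of `E`, where `v`
    -- is silent.
    let C := D + B ∘ₗ π v
    have hsum : ∑ u ∈ Aᶜ, Fintype.card (O u) =
        Fintype.card (O v) + ∑ u ∈ (insert v A)ᶜ, Fintype.card (O u) := by
      rw [Finset.compl_insert, Finset.add_sum_erase _ (fun u => Fintype.card (O u)) (Finset.mem_compl.2 hvA)]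
    have hDv : ∀ y, D y v = 0 := fun y => by simp [hD, codedMap_apply]
    have hBinj : Function.Injective B := fun x y h => by
      have := congrFun h v
      simpa [B] using this
    obtain ⟨γ, hγ⟩ := LinearMap.exists_le_finrank_range_add_comp C B (a v)
      (r := R + ∑ u ∈ Aᶜ, Fintype.card (O u))
      (by
        have hdis : LinearMap.range D ⊓ LinearMap.range B = ⊥ := by
          rw [Submodule.eq_bot_iff]
          rintro _ ⟨⟨y, rfl⟩, ⟨x, hx⟩⟩
          have h1 := congrFun hx v
          rw [hDv] at h1
          have : x = 0 := by simpa [B] using h1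
          rw [← hx, this, map_zero]
        have hsup : LinearMap.range D ⊔ LinearMap.range B ≤
            LinearMap.range C ⊔ LinearMap.range B := by
          refine sup_le ?_ le_sup_right
          rintro _ ⟨y, rfl⟩
          have : D y = C y + B (-(π v y)) := by simp [C]
          rw [this]
          exact Submodule.add_mem_sup ⟨y, rfl⟩ ⟨_, rfl⟩
        have h1 := Submodule.finrank_sup_add_finrank_inf_eq (LinearMap.range D) (LinearMap.range B)
        rw [hdis, finrank_bot, add_zero, LinearMap.finrank_range_of_inj hBinj,
          Module.finrank_fintype_fun_eq_card] at h1
        have h2 := Submodule.finrank_mono hsup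
        omega)
      (by
        have hker : LinearMap.ker (C.prod (a v)) = LinearMap.ker E := by
          ext y
          simp only [LinearMap.ker_prod, Submodule.mem_inf, LinearMap.mem_ker, funext_iff (f := C y),
            funext_iff (f := E y)]
          constructor
          · rintro ⟨h1, h2⟩ u
            have := h1 u
            by_cases huv : u = v
            · subst huv
              have h3 : π u y = 0 := by simpa [C, B, hDv] using this
              simp [hE, codedMap_apply, hvA, hvU, h2, h3]
            · have h3 : D y u = 0 := by simpa [C, B, huv] using this
              simpa [hE, hD, codedMap_apply, huv] using h3
          · intro h1
            have hv := h1 v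
            simp only [hE, codedMap_apply, hvA, hvU, if_false, Pi.zero_apply, Prod.mk_eq_zero] at hv
            refine ⟨fun u => ?_, hv.2⟩
            by_cases huv : u = v
            · subst huv
              simp [C, B, hDv, hv.1]
            · have h3 := h1 u
              simpa [hE, hD, C, B, codedMap_apply, huv] using h3
        have h1 := (C.prod (a v)).finrank_range_add_finrank_ker
        have h2 := E.finrank_range_add_finrank_ker
        rw [hker] at h1
        omega)
    classical
    -- The sign comes from the coding equation being written as `π v - β v ∘ a v`.
    refine ⟨Function.update β v (-LinearMap.toMatrix' γ), hγ.trans (le_of_eq ?_)⟩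
    suffices h : C + B ∘ₗ γ ∘ₗ a v = codedMap π a A (insert v U)
        (Function.update β v (-LinearMap.toMatrix' γ)) by rw [h]
    refine LinearMap.ext fun y => funext fun u => ?_
    by_cases huv : u = v
    · subst huv
      have : (LinearMap.toMatrix' γ).mulVec (a u y) = γ (a u y) := by
        rw [← Matrix.toLin'_apply, Matrix.toLin'_toMatrix']
      simp [C, B, hDv, codedMap_apply, hvA, Matrix.neg_mulVec, this]
    · simp [C, B, hD, codedMap_apply, huv]

end CodedMap

/-! ### States of the network and rank bounds from cuts. -/

namespace ADTNetwork

theorem IsAcyclic.wellFounded {V : Type*} [Finite V] {G : ADTNetwork V} (hG : G.IsAcyclic) :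
    WellFounded G.Adj := by
  have : Std.Irrefl (Relation.TransGen G.Adj) := ⟨hG⟩
  exact Subrelation.wf (fun h => Relation.TransGen.single h)
    (Finite.wellFounded_of_trans_of_irrefl (Relation.TransGen G.Adj))

theorem card_sigma_fin_subtype {V : Type*} [Fintype V] (n : V → ℕ) (Ω : Finset V)
    [Fintype {p : Σ v, Fin (n v) // p.1 ∈ Ω}] :
    Fintype.card {p : Σ v, Fin (n v) // p.1 ∈ Ω} = ∑ v ∈ Ω, n v := by
  rw [Fintype.card_of_subtype (Ω.sigma fun _ => Finset.univ) (by simp), Finset.card_sigma]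
  simp

variable {K V : Type*} [Field K] [Fintype V] (G : ADTNetwork V) (μ : V → ℕ)

open Classical in
/-- The symbols at the input ports, as a function of those at the output ports. -/
noncomputable def inMap (K : Type*) [Field K] : (G.OutPort → K) →ₗ[K] (G.InPort → K) :=
  LinearMap.pi fun e' => ∑ e : G.OutPort with G.Edge e e', LinearMap.proj e

open Classical in
theorem inMap_apply (y : G.OutPort → K) (e' : G.InPort) :
    G.inMap K y e' = ∑ e : G.OutPort with G.Edge e e', y e := by
  simp [inMap]

theorem inMap_eq_zero_of_adj {y : G.OutPort → K} {e' : G.InPort}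
    (h : ∀ e : G.OutPort, G.Adj e.1 e'.1 → y e = 0) : G.inMap K y e' = 0 := by
  classical
  rw [inMap_apply]
  exact Finset.sum_eq_zero fun e he => h e ⟨e.2, e'.2, (Finset.mem_filter.1 he).2⟩

open Classical in
/-- The symbols that cross the cut `Ω` are what arrives outside `Ω` where `Ω` is the only origin. -/
theorem inMap_eq_cutMatrix_transpose_mulVec (Ω : Finset V) (y : G.OutPort → K)
    (e' : {e' : G.InPort // e'.1 ∉ Ω})
    (h : ∀ e : G.OutPort, G.Adj e.1 e'.1.1 → e.1 ∉ Ω → y e = 0) :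
    G.inMap K y e' = ((G.cutMatrix K Ω).transpose.mulVec fun e => y e) e' := by
  rw [inMap_apply, Matrix.mulVec, dotProduct, Finset.sum_filter]
  rw [← Finset.sum_subset (Finset.subset_univ (Finset.univ.filter fun e : G.OutPort => e.1 ∈ Ω)),
    Finset.sum_subtype (p := fun e : G.OutPort => e.1 ∈ Ω) _ (by simp)]
  · refine Finset.sum_congr rfl fun e _ => ?_
    simp [cutMatrix]
  · intro e _ he
    split_ifs with hE
    · exact h e ⟨e.2, e'.1.2, hE⟩ (by simpa using he)
    · rfl

theorem cutValue_eq_of_algebra (F K : Type*) [Field F] [Field K] [Algebra F K] (Ω : Finset V) :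
    G.cutValue K Ω = G.cutValue F Ω := by
  classical
  have : G.cutMatrix K Ω = (G.cutMatrix F Ω).map (algebraMap F K) := by
    ext e e'
    simp [cutMatrix, apply_ite (algebraMap F K)]
  rw [cutValue, cutValue, this, Matrix.rank_map_ringHom]

theorem satisfiesCutBound_iff_of_algebra (F K : Type*) [Field F] [Field K] [Algebra F K]
    (S : Finset V) (t : V) : G.SatisfiesCutBound K μ S t ↔ G.SatisfiesCutBound F μ S t := by
  simp only [SatisfiesCutBound, G.cutValue_eq_of_algebra F K]

/-- The output symbols of `v` in a state of the network. -/
def outAt (K : Type*) [Field K] (v : V) :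
    (((Σ v, Fin (μ v)) → K) × (G.OutPort → K)) →ₗ[K] (Fin (G.numOut v) → K) :=
  LinearMap.pi fun j => LinearMap.proj ⟨v, j⟩ ∘ₗ LinearMap.snd K _ _

/-- The symbols that `v` may combine in a state of the network. -/
noncomputable def obsAt (K : Type*) [Field K] (v : V) :
    (((Σ v, Fin (μ v)) → K) × (G.OutPort → K)) →ₗ[K] (Fin (G.numIn v) ⊕ Fin (μ v) → K) :=
  LinearMap.pi fun i => Sum.elim
    (fun i => LinearMap.proj (⟨v, i⟩ : G.InPort) ∘ₗ G.inMap K ∘ₗ LinearMap.snd K _ _)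
    (fun k => LinearMap.proj (⟨v, k⟩ : Σ v, Fin (μ v)) ∘ₗ LinearMap.fst K _ _) i

-- In the kernel everything outside `Ω` vanishes. What remains is the source symbols in `Ω` and an
-- output vector on `Ω` that the transposed cut matrix kills, so the kernel has dimension at most `∑
-- μ + ∑ numOut - rank G_Ω`, with sums over `Ω`.
open Classical in
theorem le_finrank_range_codedMap_of_le_cutValue (Ω : Finset V)
    (h : ∑ v ∈ Ω, μ v ≤ G.cutValue K Ω) :
    ∑ v, μ v + ∑ v ∈ Ωᶜ, Fintype.card (Fin (G.numOut v)) ≤ Module.finrank K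
      (LinearMap.range (codedMap (G.outAt μ K) (G.obsAt μ K) Ω ∅ 0)) := by
  set L := codedMap (G.outAt μ K) (G.obsAt μ K) Ω ∅ 0 with hL
  have hker : ∀ s ∈ LinearMap.ker L, ∀ v ∉ Ω, G.outAt μ K v s = 0 ∧ G.obsAt μ K v s = 0 := by
    intro s hs v hv
    have := congrFun (LinearMap.mem_ker.1 hs) v
    simpa [hL, codedMap_apply, hv] using this
  have hy : ∀ s ∈ LinearMap.ker L, ∀ e : G.OutPort, e.1 ∉ Ω → s.2 e = 0 := fun s hs e he =>
    congrFun (hker s hs e.1 he).1 e.2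
  have hx : ∀ s ∈ LinearMap.ker L, ∀ p : Σ v, Fin (μ v), p.1 ∉ Ω → s.1 p = 0 := fun s hs p hp =>
    congrFun (hker s hs p.1 hp).2 (Sum.inr p.2)
  have hin : ∀ s ∈ LinearMap.ker L, ∀ e' : G.InPort, e'.1 ∉ Ω → G.inMap K s.2 e' = 0 :=
    fun s hs e' he' => congrFun (hker s hs e'.1 he').2 (Sum.inl e'.2)
  let N := LinearMap.ker (G.cutMatrix K Ω).transpose.mulVecLin
  let ρ : (G.OutPort → K) →ₗ[K] ({e : G.OutPort // e.1 ∈ Ω} → K) :=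
    LinearMap.funLeft K K Subtype.val
  let Ψ : LinearMap.ker L →ₗ[K] ({p : Σ v, Fin (μ v) // p.1 ∈ Ω} → K) × N :=
    (LinearMap.funLeft K K Subtype.val ∘ₗ LinearMap.fst K _ _ ∘ₗ (LinearMap.ker L).subtype).prod
      ((ρ ∘ₗ LinearMap.snd K _ _ ∘ₗ (LinearMap.ker L).subtype).codRestrict N (by
        rintro ⟨s, hs⟩
        rw [LinearMap.mem_ker]
        funext e'
        exact (G.inMap_eq_cutMatrix_transpose_mulVec Ω s.2 e' fun e _ he => hy s hs e he).symm.trans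
          (hin s hs e' e'.2)))
  have hΨ : Function.Injective Ψ := by
    rw [← LinearMap.ker_eq_bot, Submodule.eq_bot_iff]
    rintro ⟨s, hs⟩ h0
    have h1 : (Ψ ⟨s, hs⟩).1 = 0 := congrArg Prod.fst h0
    have h2 : ((Ψ ⟨s, hs⟩).2 : {e : G.OutPort // e.1 ∈ Ω} → K) = 0 :=
      congrArg Subtype.val (congrArg Prod.snd h0)
    refine Subtype.ext (Prod.ext (funext fun p => ?_) (funext fun e => ?_))
    · by_cases hp : p.1 ∈ Ω
      · exact congrFun h1 ⟨p, hp⟩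
      · exact hx s hs p hp
    · by_cases he : e.1 ∈ Ω
      · exact congrFun h2 ⟨e, he⟩
      · exact hy s hs e he
  have h1 := LinearMap.finrank_le_finrank_of_injective hΨ
  have h2 := L.finrank_range_add_finrank_ker
  have h3 := (G.cutMatrix K Ω).transpose.mulVecLin.finrank_range_add_finrank_ker
  have h4 : Module.finrank K (LinearMap.range (G.cutMatrix K Ω).transpose.mulVecLin) =
      G.cutValue K Ω := by
    rw [cutValue, ← Matrix.rank_transpose]
    rfl
  rw [Module.finrank_prod, Module.finrank_fintype_fun_eq_card, card_sigma_fin_subtype] at h1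
  rw [Module.finrank_fintype_fun_eq_card, card_sigma_fin_subtype, h4] at h3
  rw [Module.finrank_prod, Module.finrank_fintype_fun_eq_card, Module.finrank_fintype_fun_eq_card,
    Fintype.card_sigma, Fintype.card_sigma] at h2
  have h5 := Finset.sum_add_sum_compl Ω G.numOut
  simp only [Fintype.card_fin] at h2 ⊢
  change _ + Module.finrank K N = _ at h3
  omega

-- With no free node left, the rank bound `∑ μ + ∑ numOut` is the dimension of the whole state
-- space, so the code makes the map injective.
open Classical in
theorem exists_injective_codedMap [Infinite K] {S : Finset V} (hμ : ∀ v, v ∉ S → μ v = 0) {t : V}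
    (ht : G.SatisfiesCutBound K μ S t) :
    ∃ β, Module.finrank K (((Σ v, Fin (μ v)) → K) × (G.OutPort → K)) ≤ Module.finrank K
      (LinearMap.range (codedMap (G.outAt μ K) (G.obsAt μ K) ∅ (Finset.univ.erase t) β)) := by
  obtain ⟨β, hβ⟩ := exists_le_finrank_range_codedMap (G.outAt μ K) (G.obsAt μ K) (∑ v, μ v)
    (Finset.univ.erase t) ∅ (Finset.disjoint_empty_left _) fun Ω _ hΩ =>
      G.le_finrank_range_codedMap_of_le_cutValue μ Ω (by
        have htΩ : t ∉ Ω := fun h => by simpa using hΩ h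
        have hsum : ∑ v ∈ Ω, μ v = ∑ s ∈ S with s ∈ Ω, μ s := by
          rw [Finset.filter_mem_eq_inter, Finset.inter_comm]
          refine (Finset.sum_subset Finset.inter_subset_left fun v hv hv' => hμ v fun hS => ?_).symm
          exact hv' (Finset.mem_inter.2 ⟨hv, hS⟩)
        rw [hsum]
        -- The bound is assumed only for cuts containing a source; for the others the total rate is
        -- zero.
        by_cases h : ∃ s ∈ S, s ∈ Ω
        · exact ht Ω h htΩ
        · rw [Finset.sum_eq_zero]
          · exact Nat.zero_le _
          · intro s hs
            exact absurd ⟨s, (Finset.mem_filter.1 hs)⟩ h)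
  refine ⟨β, le_trans (le_of_eq ?_) hβ⟩
  rw [Module.finrank_prod, Module.finrank_fintype_fun_eq_card, Module.finrank_fintype_fun_eq_card,
    Fintype.card_sigma, Fintype.card_sigma]
  simp

end ADTNetwork

/-- A finite field has arbitrarily large finite extension fields in its universe. -/
theorem FiniteField.exists_extension_lt_card (F : Type u) [Field F] [Finite F] (n : ℕ) :
    ∃ (K : Type u) (_ : Field K) (_ : Finite K) (_ : Algebra F K), n < Nat.card K := by
  obtain ⟨p, hp⟩ := CharP.exists F
  have : Fact p.Prime := ⟨CharP.char_is_prime F p⟩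
  let _ : Algebra (ZMod p) F := ZMod.algebra F p
  refine ⟨ULift (FiniteField.Extension F p (n + 1)), inferInstance, ?_, inferInstance, ?_⟩
  · have := Module.finite_of_finite F (M := FiniteField.Extension F p (n + 1))
    infer_instance
  · rw [Nat.card_congr Equiv.ulift, FiniteField.natCard_extension]
    exact (Nat.lt_succ_self n).trans (Nat.lt_pow_self Finite.one_lt_card)

/-! ### Transfer maps, decoding, and the two directions of the criterion. -/

namespace ADTNetwork

variable {F V : Type*} [Field F] {G : ADTNetwork V} {μ : V → ℕ}

namespace LinearCode

/-- The contribution of the source processes to the output ports. -/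
noncomputable def sourceMap (c : LinearCode F G μ) :
    ((Σ v, Fin (μ v)) → F) →ₗ[F] (G.OutPort → F) :=
  LinearMap.pi fun e => ∑ k, c.α e.1 k e.2 • LinearMap.proj (⟨e.1, k⟩ : Σ v, Fin (μ v))

theorem sourceMap_apply (c : LinearCode F G μ) (x : (Σ v, Fin (μ v)) → F) (e : G.OutPort) :
    c.sourceMap x e = ∑ k, c.α e.1 k e.2 * x ⟨e.1, k⟩ := by
  simp [sourceMap]

variable [Fintype V]

/-- The contribution of the input ports to the output ports, in terms of the output ports. -/
noncomputable def relayMap (c : LinearCode F G μ) : (G.OutPort → F) →ₗ[F] (G.OutPort → F) :=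
  LinearMap.pi fun e => ∑ i, c.β e.1 i e.2 • (LinearMap.proj (⟨e.1, i⟩ : G.InPort) ∘ₗ G.inMap F)

theorem relayMap_apply (c : LinearCode F G μ) (y : G.OutPort → F) (e : G.OutPort) :
    c.relayMap y e = ∑ i, c.β e.1 i e.2 * G.inMap F y ⟨e.1, i⟩ := by
  simp [relayMap]

theorem carries_iff (c : LinearCode F G μ) (x : (Σ v, Fin (μ v)) → F) (yIn : G.InPort → F)
    (yOut : G.OutPort → F) :
    c.Carries x yIn yOut ↔ yIn = G.inMap F yOut ∧ yOut = c.relayMap yOut + c.sourceMap x := by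
  have h : (∀ e' : G.InPort, yIn e' = G.inMap F yOut e') ↔ yIn = G.inMap F yOut :=
    funext_iff.symm
  unfold Carries
  simp only [← inMap_apply, h]
  refine and_congr_right fun hy => ?_
  subst hy
  rw [funext_iff (f := yOut), Sigma.forall]
  simp only [Pi.add_apply, relayMap_apply, sourceMap_apply]

/-- In an acyclic network the source symbols determine all symbols, linearly. -/
theorem exists_transferMap (hG : G.IsAcyclic) (c : LinearCode F G μ) :
    ∃ M : ((Σ v, Fin (μ v)) → F) →ₗ[F] (G.OutPort → F),
      ∀ x y, y = c.relayMap y + c.sourceMap x ↔ y = M x := by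
  -- Without source symbols, all outputs vanish by induction along the acyclic order. An injective
  -- endomorphism in finite dimension is invertible.
  have hinj : Function.Injective ((LinearMap.id : (G.OutPort → F) →ₗ[F] _) - c.relayMap) := by
    rw [← LinearMap.ker_eq_bot, Submodule.eq_bot_iff]
    intro y hy
    have hy' : y = c.relayMap y := sub_eq_zero.1 hy
    suffices h : ∀ v j, y ⟨v, j⟩ = 0 from funext fun e => h e.1 e.2
    intro v
    induction v using hG.wellFounded.induction with
    | _ v ih =>
    intro j
    rw [hy', relayMap_apply]
    refine Finset.sum_eq_zero fun i _ => ?_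
    rw [G.inMap_eq_zero_of_adj fun e he => ih e.1 he e.2, mul_zero]
  let Φ := LinearEquiv.ofInjectiveEndo _ hinj
  refine ⟨Φ.symm.toLinearMap ∘ₗ c.sourceMap, fun x y => ?_⟩
  rw [LinearMap.comp_apply, LinearEquiv.coe_coe, LinearEquiv.eq_symm_apply, ← sub_eq_iff_eq_add']
  exact Iff.rfl

end LinearCode

variable [Fintype V]

/-- A code from which every destination can tell the source symbols apart can be completed by
linear decoders. -/
theorem solvable_multipleMulticast_of_injective (hG : G.IsAcyclic) {S T : Finset V}
    (c : LinearCode F G μ)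
    (h : ∀ t ∈ T, ∀ x y, y = c.relayMap y + c.sourceMap x → (∀ i, G.inMap F y ⟨t, i⟩ = 0) →
      x = 0) :
    G.Solvable F μ (multipleMulticast μ S T) := by
  classical
  obtain ⟨M, hM⟩ := c.exists_transferMap hG
  let θ : ∀ t, ((Σ v, Fin (μ v)) → F) →ₗ[F] (Fin (G.numIn t) → F) := fun t =>
    LinearMap.pi fun i => LinearMap.proj (⟨t, i⟩ : G.InPort) ∘ₗ G.inMap F ∘ₗ M
  have hdec : ∀ t, ∃ D : (Fin (G.numIn t) → F) →ₗ[F] ((Σ v, Fin (μ v)) → F),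
      t ∈ T → ∀ x, D (θ t x) = x := by
    intro t
    by_cases ht : t ∈ T
    · have hker : LinearMap.ker (θ t) = ⊥ := by
        rw [Submodule.eq_bot_iff]
        exact fun x hx => h t ht x (M x) ((hM x _).2 rfl) fun i => congrFun hx i
      obtain ⟨D, hD⟩ := (θ t).exists_leftInverse_of_injective hker
      exact ⟨D, fun _ x => LinearMap.congr_fun hD x⟩
    · exact ⟨0, fun ht' => absurd ht' ht⟩
  choose D hD using hdec
  let c' : LinearCode F G μ := ⟨c.α, c.β, fun t i p => D t (Pi.single i 1) p⟩
  have hc' : ∀ x yIn yOut, c'.Carries x yIn yOut ↔ c.Carries x yIn yOut := fun _ _ _ => Iff.rfl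
  refine ⟨c', fun x => ⟨⟨G.inMap F (M x), M x, ?_⟩, fun yIn yOut hy a ha k _ => ?_⟩⟩
  · rw [hc', LinearCode.carries_iff]
    exact ⟨rfl, (hM x _).2 rfl⟩
  · rw [hc', LinearCode.carries_iff, hM] at hy
    obtain ⟨rfl, rfl⟩ := hy
    have h1 := congrFun (hD a.dst ha.2.1 x) ⟨a.src, k⟩
    rw [← h1, LinearMap.pi_apply_eq_sum_univ (D a.dst), Finset.sum_apply]
    refine Finset.sum_congr rfl fun i _ => ?_
    rw [Pi.smul_apply, smul_eq_mul, mul_comm]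
    have : (fun j => if i = j then (1 : F) else 0) = Pi.single i 1 := by
      funext j
      simp [Pi.single_apply, eq_comm]
    rw [this]
    rfl

/-- In a solvable multicast problem, the processes of the sources in `Ω` cross the cut `Ω`. -/
theorem satisfiesCutBound_of_solvable (hG : G.IsAcyclic) {S T : Finset V}
    (hμ : ∀ v, v ∉ S → μ v = 0) (h : G.Solvable F μ (multipleMulticast μ S T)) {t : V}
    (ht : t ∈ T) : G.SatisfiesCutBound F μ S t := by
  classical
  intro Ω _ htΩ
  obtain ⟨c, hc⟩ := h
  obtain ⟨M, hM⟩ := c.exists_transferMap hG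
  let ext : ({p : Σ v, Fin (μ v) // p.1 ∈ Ω} → F) →ₗ[F] ((Σ v, Fin (μ v)) → F) :=
    LinearMap.pi fun p => if hp : p.1 ∈ Ω then LinearMap.proj ⟨p, hp⟩ else 0
  let ρ : (G.OutPort → F) →ₗ[F] ({e : G.OutPort // e.1 ∈ Ω} → F) :=
    LinearMap.funLeft F F Subtype.val
  let χ := (G.cutMatrix F Ω).transpose.mulVecLin
  have hinj : Function.Injective (χ ∘ₗ ρ ∘ₗ M ∘ₗ ext) := by
    rw [← LinearMap.ker_eq_bot, Submodule.eq_bot_iff]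
    intro x hx
    have hy := (hM (ext x) _).2 rfl
    set y := M (ext x)
    have hcut : ∀ e', (χ (ρ y)) e' = 0 := fun e' => congrFun hx e'
    -- Silence spreads outside `Ω`: no source there is active, nothing crosses the cut, and earlier
    -- nodes outside `Ω` are silent by induction.
    have hout : ∀ v, v ∉ Ω → ∀ j, y ⟨v, j⟩ = 0 := by
      intro v
      induction v using hG.wellFounded.induction with
      | _ v ih =>
      intro hv j
      rw [hy, Pi.add_apply, LinearCode.relayMap_apply, LinearCode.sourceMap_apply,
        Finset.sum_eq_zero, Finset.sum_eq_zero, add_zero]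
      · intro k _
        simp [ext, hv]
      · intro i _
        rw [G.inMap_eq_cutMatrix_transpose_mulVec Ω y ⟨⟨v, i⟩, hv⟩
          fun e he he' => ih e.1 he he' e.2]
        exact mul_eq_zero_of_right _ (hcut ⟨⟨v, i⟩, hv⟩)
    have hin : ∀ i, G.inMap F y ⟨t, i⟩ = 0 := fun i =>
      (G.inMap_eq_cutMatrix_transpose_mulVec Ω y ⟨⟨t, i⟩, htΩ⟩
        fun e _ he' => hout e.1 he' e.2).trans (hcut ⟨⟨t, i⟩, htΩ⟩)
    funext ⟨p, hp⟩
    have hS : p.1 ∈ S := by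
      by_contra hS
      exact (Fin.cast (hμ _ hS) p.2).elim0
    have := (hc (ext x)).2 _ y ((c.carries_iff _ _ _).2 ⟨rfl, hy⟩) ⟨p.1, t, Finset.univ⟩
      ⟨hS, ht, rfl⟩ p.2 (Finset.mem_univ _)
    simp only [LinearCode.decode, hin, mul_zero, Finset.sum_const_zero] at this
    simpa [ext, hp] using this.symm
  have h1 := LinearMap.finrank_range_of_inj hinj
  rw [Module.finrank_fintype_fun_eq_card, card_sigma_fin_subtype] at h1
  have h2 : Module.finrank F (LinearMap.range (χ ∘ₗ ρ ∘ₗ M ∘ₗ ext)) ≤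
      Module.finrank F (LinearMap.range χ) :=
    Submodule.finrank_mono (LinearMap.range_comp_le_range _ _)
  have h3 : Module.finrank F (LinearMap.range χ) = G.cutValue F Ω := by
    rw [cutValue, ← Matrix.rank_transpose]
    rfl
  calc ∑ s ∈ S with s ∈ Ω, μ s ≤ ∑ v ∈ Ω, μ v :=
        Finset.sum_le_sum_of_subset fun v hv => (Finset.mem_filter.1 hv).2
    _ ≤ G.cutValue F Ω := by omega

theorem map_inMap {K : Type*} [Field K] (f : F →+* K) (y : G.OutPort → F) (e' : G.InPort) :
    G.inMap K (fun e => f (y e)) e' = f (G.inMap F y e') := by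
  rw [inMap_apply, inMap_apply, map_sum]

/-- Over a field with more elements than there are destinations, the cut bound suffices. -/
theorem solvable_of_satisfiesCutBound [Finite F] (hG : G.IsAcyclic) {S T : Finset V}
    (hST : Disjoint S T) (hμ : ∀ v, v ∉ S → μ v = 0) (hT : T.card < Nat.card F)
    (h : ∀ t ∈ T, G.SatisfiesCutBound F μ S t) :
    G.Solvable F μ (multipleMulticast μ S T) := by
  classical
  have := Fintype.ofFinite F
  -- The closure serves only as an infinite field for the codes of single destinations; the common
  -- coefficients are taken from the image of `F`.
  let K := AlgebraicClosure F
  let f := algebraMap F K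
  obtain ⟨β, hβF, hβ⟩ := exists_common_le_finrank_range_codedMap (G.outAt μ K) (G.obsAt μ K)
    (fun _ : {t // t ∈ T} => ∅) (fun t => Finset.univ.erase t.1)
    (fun _ => Module.finrank K (((Σ v, Fin (μ v)) → K) × (G.OutPort → K)))
    (Finset.univ.image f)
    (by
      rw [Finset.card_image_of_injective _ f.injective, Finset.card_univ, Fintype.card_coe,
        ← Nat.card_eq_fintype_card]
      exact hT)
    (fun t => by
      convert G.exists_injective_codedMap μ hμ
        ((G.satisfiesCutBound_iff_of_algebra μ F K S t.1).2 (h t.1 t.2)))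
  have hβ' : ∀ v o i, ∃ z, f z = β v o i := fun v o i => by simpa using hβF v o i
  choose b hb using hβ'
  let c : LinearCode F G μ :=
    ⟨fun v k j => b v j (Sum.inr k), fun v i j => b v j (Sum.inl i), fun _ _ _ => 0⟩
  refine solvable_multipleMulticast_of_injective hG c fun t ht x y hy hin => ?_
  have hL := hβ ⟨t, ht⟩
  set L := codedMap (G.outAt μ K) (G.obsAt μ K) ∅ (Finset.univ.erase t) β
  have hker : LinearMap.ker L = ⊥ := by
    rw [← Submodule.finrank_eq_zero]
    have := L.finrank_range_add_finrank_ker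
    omega
  -- Disjointness of sources and destinations matters here: without processes of its own, `t` sends
  -- nothing when it receives nothing, so the state satisfies the silence equations at `t`.
  have hμt : μ t = 0 := hμ t (Finset.disjoint_right.1 hST ht)
  have hμt' : IsEmpty (Fin (μ t)) := by rw [hμt]; infer_instance
  have hmem : ((fun p => f (x p), fun e => f (y e)) :
      ((Σ v, Fin (μ v)) → K) × (G.OutPort → K)) ∈ LinearMap.ker L := by
    rw [LinearMap.mem_ker]
    funext v
    rw [codedMap_apply, if_neg (Finset.notMem_empty v), Pi.zero_apply]
    by_cases hv : v = t
    · subst hv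
      rw [if_neg (Finset.notMem_erase _ _), Prod.mk_eq_zero]
      constructor
      · funext j
        change f (y ⟨v, j⟩) = 0
        rw [congrFun hy ⟨v, j⟩, Pi.add_apply, LinearCode.relayMap_apply, LinearCode.sourceMap_apply]
        simp [hin]
      · funext i
        rcases i with i | k
        · exact (map_inMap f y ⟨v, i⟩).trans ((congrArg f (hin i)).trans (map_zero f))
        · exact hμt'.elim k
    · rw [if_pos (Finset.mem_erase.2 ⟨hv, Finset.mem_univ v⟩), Prod.mk_eq_zero]
      refine ⟨sub_eq_zero.2 (funext fun j => ?_), rfl⟩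
      change f (y ⟨v, j⟩) = _
      rw [congrFun hy ⟨v, j⟩, Pi.add_apply, LinearCode.relayMap_apply, LinearCode.sourceMap_apply, map_add, map_sum,
        map_sum, Matrix.mulVec, dotProduct, Fintype.sum_sum_type]
      congr 1
      · refine Finset.sum_congr rfl fun i _ => ?_
        rw [map_mul, hb]
        congr 1
        exact (map_inMap f y ⟨v, i⟩).symm
      · refine Finset.sum_congr rfl fun k _ => ?_
        rw [map_mul, hb]
        rfl
  rw [hker, Submodule.mem_bot, Prod.mk_eq_zero] at hmem
  funext p
  exact f.injective ((congrFun hmem.1 p).trans (map_zero f).symm)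

end ADTNetwork

theorem mainTheorem8 {V : Type v} [Fintype V] {F : Type u} [Field F] [Finite F]
    (G : ADTNetwork V) (hG : G.IsAcyclic) (μ : V → ℕ) (S T : Finset V) (hST : Disjoint S T)
    (hμ : ∀ v, v ∉ S → μ v = 0) :
    ((∃ (K : Type u) (_ : Field K) (_ : Finite K) (_ : Algebra F K),
        G.Solvable K μ (ADTNetwork.multipleMulticast μ S T)) ↔
      ∀ t ∈ T, G.SatisfiesCutBound F μ S t) ∧
    (T.card < Nat.card F →
      (G.Solvable F μ (ADTNetwork.multipleMulticast μ S T) ↔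
        ∀ t ∈ T, G.SatisfiesCutBound F μ S t)) := by
  refine ⟨⟨?_, fun h => ?_⟩, fun hq => ⟨fun h t ht => ?_, fun h => ?_⟩⟩
  · rintro ⟨K, _, _, _, h⟩ t ht
    exact (G.satisfiesCutBound_iff_of_algebra μ F K S t).1
      (ADTNetwork.satisfiesCutBound_of_solvable hG hμ h ht)
  · obtain ⟨K, hField, hFinite, hAlg, hK⟩ := FiniteField.exists_extension_lt_card F T.card
    refine ⟨K, hField, hFinite, hAlg, ?_⟩
    exact ADTNetwork.solvable_of_satisfiesCutBound hG hST hμ hK fun t ht =>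
      (G.satisfiesCutBound_iff_of_algebra μ F K S t).2 (h t ht)
  · exact ADTNetwork.satisfiesCutBound_of_solvable hG hμ h ht
  · exact ADTNetwork.solvable_of_satisfiesCutBound hG hST hμ hq h
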